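/- Let $B>0$, $\mathcal Y=[-B,B]$, let $\mathcal X$ be a measurable space with a $\sigma$-finite reference measure $dx'$, and let $D$ be a probability distribution on $\mathcal X\times\mathcal Y$. For each $x\in\mathcal X$ let $N_x$ (the mirrored neighborhood of $x$) be a probability distribution on $\mathcal X$, depending measurably on $x$, with a density $p_{N_x}$ with respect to $dx'$. Let $\mathcal F$ be a class of measurable functions $f:\mathcal X\to\mathcal Y$, let $\mathcal G_{\rm local}$ be a class of functions $\mathcal X\to\mathcal Y$, and let $\mathcal G$ be a class of measurable explainers $g:\mathcal X\times\mathcal X\to\mathcal Y$ such that $g_{x'}=g(x',\cdot)\in\mathcal G_{\rm local}$ for every $x'\in\mathcal X$. Assume the usual measurability of suprema over $\mathcal G$: with $\ell_g(x,y)=\mathbb E_{x'\sim N_x}[(g_{x'}(x)-y)^2]$, for all $n\ge 0$ and real $e_1,\dots,e_n,c$ the map $(z_1,\dots,z_n)\mapsto\sup_{g\in\mathcal G}\big(\sum_i e_i\ell_g(z_i)+c\,\mathbb E_D[\ell_g]\big)$ on $(\mathcal X\times\mathcal Y)^n$ is measurable (this holds for instance if $\mathcal G$ is countable). For points $x_1,\dots,x_m$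 put $$\rho_S=\int_{\mathcal X}\sqrt{\tfrac1m\sum_{i=1}^m p_{N_{x_i}}(x')^2}\,dx',\qquad \hat{\mathcal R}^*_S(\mathcal G_{\rm local})=\max_{\emptyset\ne T\subseteq\{1,\dots,m\}}\sqrt{\tfrac{|T|}{m}}\;\mathbb E_\sigma\Big[\sup_{h\in\mathcal G_{\rm local}}\tfrac1{|T|}\sum_{i\in T}\sigma_i h(x_i)\Big],$$ where $\sigma$ is uniform on $\{-1,1\}^T$. Let $m\ge1$ and $0<\delta<1$. Then with probability at least $1-\delta$ over $S=\{(x_i,y_i)\}_{i=1}^m\sim D^m$, simultaneously for all $f\in\mathcal F$ and $g\in\mathcal G$, $$\begin{aligned}\mathbb E_{(x,y)\sim D}[(f(x)-y)^2]\le{}&\frac4m\sum_{i=1}^m(f(x_i)-y_i)^2+2\,\mathbb E_{x\sim D}\mathbb E_{x'\sim N_x}[(f(x)-g_{x'}(x))^2]+\frac4m\sum_{i=1}^m\mathbb E_{x'\sim N_{x_i}}[(f(x_i)-g_{x'}(x_i))^2]\\&+16B\,\rho_S\,\hat{\mathcal R}^*_S(\mathcal G_{\rm local})(\ln m+1)+8B^2\sqrt{\frac{2\ln(1/\delta)}{m}}.\end{aligned}$$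 (If the event is not measurable, the statement is that its complement has outer probability at most $\delta$.) -/

import Mathlib

open MeasureTheory ProbabilityTheory
open scoped BigOperators ENNReal

noncomputable section

/-- The label space `[-B, B]`. -/
abbrev LabelSpace (B : ℝ) : Type := ↥(Set.Icc (-B) B)

variable {X : Type*} {B : ℝ}

/-- The mean squared error `E_{(x,y) ∼ D} (f x - y)²`. -/
def testMSE [MeasurableSpace X] (D : Measure (X × LabelSpace B)) (f : X → LabelSpace B) : ℝ :=
  ∫ z, ((f z.1 : ℝ) - (z.2 : ℝ)) ^ 2 ∂D

/-- The mean squared error of `f` on a finite sample. -/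
def trainMSE {m : ℕ} (S : Fin m → X × LabelSpace B) (f : X → LabelSpace B) : ℝ :=
  (1 / (m : ℝ)) * ∑ i, ((f (S i).1 : ℝ) - ((S i).2 : ℝ)) ^ 2

/-- Mirrored neighborhood fidelity at a target point `x`: the source point `x'` is drawn from the
mirrored neighborhood distribution `N x`, and the local explanation is `g x' : X → [-B, B]`. -/
def mnfAt [MeasurableSpace X] (N : Kernel X X) (f : X → LabelSpace B)
    (g : X → X → LabelSpace B) (x : X) : ℝ :=
  ∫ x', ((f x : ℝ) - (g x' x : ℝ)) ^ 2 ∂(N x)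

/-- Mirrored neighborhood fidelity: the target point is drawn from (the first marginal of) `D`. -/
def mnf [MeasurableSpace X] (D : Measure (X × LabelSpace B)) (N : Kernel X X)
    (f : X → LabelSpace B) (g : X → X → LabelSpace B) : ℝ :=
  ∫ z, mnfAt N f g z.1 ∂D

/-- The average of the mirrored neighborhood fidelity over a finite sample. -/
def empiricalMNF [MeasurableSpace X] (N : Kernel X X) {m : ℕ} (S : Fin m → X × LabelSpace B)
    (f : X → LabelSpace B) (g : X → X → LabelSpace B) : ℝ :=
  (1 / (m : ℝ)) * ∑ i, mnfAt N f g (S i).1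

/-- The neighborhood disjointedness factor
`ρ = ∫ √((1/m) ∑ᵢ p_{N (x i)}(x')²) dμ(x')`, where `p_{N x}` is the density of `N x` with respect
to the reference measure `μ`. -/
def disjointednessFactor [MeasurableSpace X] (μ : Measure X) (N : Kernel X X) {m : ℕ}
    (x : Fin m → X) : ℝ :=
  ∫ x', √((1 / (m : ℝ)) * ∑ i, ((N (x i)).rnDeriv μ x').toReal ^ 2) ∂μ

/-- The empirical Rademacher complexity `E_σ sup_{h ∈ H} (1/n) ∑ᵢ σᵢ h(xᵢ)` on a finite family of
points, with `σ` uniform on `{-1, 1}^n`. -/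
def empiricalRademacher (H : Set (X → LabelSpace B)) {ι : Type*} [Fintype ι] [DecidableEq ι]
    (x : ι → X) : ℝ :=
  𝔼 σ : ι → ℤˣ, ⨆ h : H,
    (1 / (Fintype.card ι : ℝ)) * ∑ i, ((σ i : ℤ) : ℝ) * (h.1 (x i) : ℝ)

/-- The maximum, over the nonempty subsamples `T` of the sample, of the empirical Rademacher
complexity on `T` times `√(|T| / m)`. -/
def maxRademacher (H : Set (X → LabelSpace B)) {m : ℕ} (x : Fin m → X) : ℝ :=
  ⨆ T : {T : Finset (Fin m) // T.Nonempty},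
    empiricalRademacher H (fun i : ↥T.1 => x i) * √((T.1.card : ℝ) / (m : ℝ))

/-- The squared loss of the randomized predictor `x ↦ g x' x`, `x' ∼ N x`, at a labeled point. -/
def explainerLoss [MeasurableSpace X] (N : Kernel X X) (g : X → X → LabelSpace B)
    (z : X × LabelSpace B) : ℝ :=
  ∫ x', ((g x' z.1 : ℝ) - (z.2 : ℝ)) ^ 2 ∂(N z.1)

/-- The usual measurability requirement of empirical process theory on a (possibly uncountable)
class: suprema over the class of linear combinations of the losses at sample points and of the
expected loss are measurable functions of the sample. For each sample the supremum is over a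
bounded set. Every countable class of measurable explainers satisfies this. -/
def IsMeasurableClass [MeasurableSpace X] (D : Measure (X × LabelSpace B)) (N : Kernel X X)
    (G : Set (X → X → LabelSpace B)) : Prop :=
  ∀ (n : ℕ) (e : Fin n → ℝ) (c : ℝ), Measurable fun s : Fin n → X × LabelSpace B =>
    ⨆ g : G, (∑ i, e i * explainerLoss N g.1 (s i) + c * ∫ z, explainerLoss N g.1 z ∂D)

end

/-! The randomized predictor `x ↦ g x' x`, `x' ∼ N x`, stands between `f` and the labels.
Integrating `(f - y)² ≤ 2(f - g)² + 2(g - y)²` over `x'` bounds the test error of `f` by twice the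
fidelity plus twice the expected explainer loss (`testMSE_le`). The same inequality bounds the
empirical explainer loss by empirical fidelity and training error (`explainerLoss_le`). Hence only
the explainers must generalize, and the complexity of `F` never enters.

For the explainer losses, bounded differences are applied once, to the supremum of the deviations
minus twice the empirical Rademacher sum. By symmetrization its mean is at most zero
(`measure_uniform_deviation_le`).

The Rademacher sum is then bounded in `rademacherSum_explainerLoss_le`. With densities against `μ`,
the supremum moves inside the integral over `x'`. For fixed `x'` the explainer is a single `g x' ∈
Gloc`, and the loss at the `i`-th point has weight `p_{N xᵢ}(x')`. Contraction removes the square at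
the cost of a factor `4B`. Abel summation along the decreasing order of the weights reduces the
weighted sum to unweighted subsamples, each controlled by `maxRademacher`. Cauchy–Schwarz and the
harmonic sum leave the `ℓ²` norm of the weights times `log m + 1`; integrating that norm over `x'`
produces the disjointedness factor. -/

/-! ### Rademacher sums: contraction and sensitivity to one coordinate -/

/-- Averaging over independent signs, one sign can be resolved explicitly. -/
theorem expect_signs_eq_update {ι : Type*} [Fintype ι] [DecidableEq ι] (i : ι)
    (F : (ι → ℤˣ) → ℝ) :
    𝔼 σ : ι → ℤˣ, F σ =
      𝔼 σ : ι → ℤˣ, (F (Function.update σ i 1) + F (Function.update σ i (-1))) / 2 := by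
  have hinv : Function.Involutive
      (fun σ : ι → ℤˣ => Function.update σ i (-σ i)) := by
    intro σ; simp
  have h1 : 𝔼 σ : ι → ℤˣ, F σ = 𝔼 σ : ι → ℤˣ, F (Function.update σ i (-σ i)) :=
    (Fintype.expect_bijective _ hinv.bijective _ _ fun _ => rfl).symm
  have h2 : ∀ σ : ι → ℤˣ, F (Function.update σ i 1) + F (Function.update σ i (-1)) =
      F σ + F (Function.update σ i (-σ i)) := by
    intro σ
    rcases Int.units_eq_one_or (σ i) with h | h
    · have : Function.update σ i 1 = σ := by rw [← h, Function.update_eq_self]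
      rw [this, h]
    · have : Function.update σ i (-1) = σ := by rw [← h, Function.update_eq_self]
      rw [this, h, neg_neg, add_comm]
  simp_rw [h2]
  rw [← Finset.expect_div, Finset.expect_add_distrib, ← h1]
  ring

/-- The expected supremum `E_σ sup_h ∑ᵢ σᵢ a i h` over uniform signs. -/
noncomputable def rademacherSum {ι H : Type*} [Fintype ι] [DecidableEq ι] (a : ι → H → ℝ) : ℝ :=
  𝔼 σ : ι → ℤˣ, ⨆ h, ∑ i, ((σ i : ℤ) : ℝ) * a i h

theorem abs_sum_mul_le {ι H : Type*} [Fintype ι] {a : ι → H → ℝ} {C : ℝ}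
    (ha : ∀ i h, |a i h| ≤ C) (e : ι → ℝ) (h : H) :
    |∑ i, e i * a i h| ≤ (∑ i, |e i|) * C := by
  rw [Finset.sum_mul]
  refine (Finset.abs_sum_le_sum_abs _ _).trans (Finset.sum_le_sum fun i _ => ?_)
  rw [abs_mul]
  exact mul_le_mul_of_nonneg_left (ha i h) (abs_nonneg _)

theorem bddAbove_range_sum_mul {ι H : Type*} [Fintype ι] {a : ι → H → ℝ} {C : ℝ}
    (ha : ∀ i h, |a i h| ≤ C) (e : ι → ℝ) :
    BddAbove (Set.range fun h => ∑ i, e i * a i h) := by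
  refine ⟨(∑ i, |e i|) * C, ?_⟩
  rintro _ ⟨h, rfl⟩
  exact (le_abs_self _).trans (abs_sum_mul_le ha e h)

/-- The two suprema may be approached at different indices, so the bound is required for every pair
`x`, `y`. -/
theorem ciSup_add_ciSup_le_of_forall {H : Type*} [Nonempty H] {f g : H → ℝ} {c : ℝ}
    (h : ∀ x y, f x + g y ≤ c) : (⨆ x, f x) + ⨆ x, g x ≤ c := by
  have h1 : ∀ y, (⨆ x, f x) ≤ c - g y := fun y => ciSup_le fun x => by linarith [h x y]
  have h2 : (⨆ x, g x) ≤ c - ⨆ x, f x := ciSup_le fun y => by linarith [h1 y]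
  linarith

theorem ciSup_le_ciSup_add {H : Type*} [Nonempty H] {f g : H → ℝ} {c : ℝ}
    (hg : BddAbove (Set.range g)) (h : ∀ x, f x ≤ g x + c) : (⨆ x, f x) ≤ (⨆ x, g x) + c :=
  ciSup_le fun x => (h x).trans (by linarith [le_ciSup hg x])

theorem abs_ciSup_sub_ciSup_le {H : Type*} [Nonempty H] {f g : H → ℝ} {c : ℝ}
    (hf : BddAbove (Set.range f)) (hg : BddAbove (Set.range g)) (h : ∀ x, |f x - g x| ≤ c) :
    |(⨆ x, f x) - ⨆ x, g x| ≤ c := by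
  rw [abs_le]
  have h1 := ciSup_le_ciSup_add (f := f) hg fun x => by linarith [(abs_le.1 (h x)).2]
  have h2 := ciSup_le_ciSup_add (f := g) hf fun x => by linarith [(abs_le.1 (h x)).1]
  constructor <;> linarith

/-- Resolving one sign in `rademacherSum` and comparing the two resulting suprema. -/
theorem rademacherSum_update_le_of_pair {ι H : Type*} [Fintype ι] [DecidableEq ι]
    (a : ι → H → ℝ) (i : ι) (u v : H → ℝ) (c : ℝ)
    (hpair : ∀ σ : ι → ℤˣ,
      (⨆ h, ((∑ j ∈ Finset.univ.erase i, ((σ j : ℤ) : ℝ) * a j h) + u h)) +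
        (⨆ h, ((∑ j ∈ Finset.univ.erase i, ((σ j : ℤ) : ℝ) * a j h) - u h)) ≤
      (⨆ h, ((∑ j ∈ Finset.univ.erase i, ((σ j : ℤ) : ℝ) * a j h) + v h)) +
        (⨆ h, ((∑ j ∈ Finset.univ.erase i, ((σ j : ℤ) : ℝ) * a j h) - v h)) + c) :
    rademacherSum (Function.update a i u) ≤ rademacherSum (Function.update a i v) + c / 2 := by
  have key : ∀ (w : H → ℝ) (σ : ι → ℤˣ) (ε : ℤˣ) (h : H),
      ∑ j, ((Function.update σ i ε j : ℤ) : ℝ) * Function.update a i w j h =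
        (∑ j ∈ Finset.univ.erase i, ((σ j : ℤ) : ℝ) * a j h) + ((ε : ℤ) : ℝ) * w h := by
    intro w σ ε h
    rw [← Finset.sum_erase_add _ _ (Finset.mem_univ i)]
    simp only [Function.update_self]
    congr 1
    refine Finset.sum_congr rfl fun j hj => ?_
    rw [Function.update_of_ne (Finset.ne_of_mem_erase hj),
      Function.update_of_ne (Finset.ne_of_mem_erase hj)]
  unfold rademacherSum
  -- Each pair of signs is averaged, which is why `c` enters halved.
  rw [expect_signs_eq_update i, expect_signs_eq_update i
    (fun σ => ⨆ h, ∑ j, ((σ j : ℤ) : ℝ) * Function.update a i v j h),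
    ← Fintype.expect_const (ι := ι → ℤˣ) (c / 2), ← Finset.expect_add_distrib]
  refine Finset.expect_le_expect fun σ _ => ?_
  simp_rw [key]
  have := hpair σ
  simp only [Units.val_one, Int.cast_one, one_mul, Units.val_neg, Int.cast_neg, neg_mul,
    ← sub_eq_add_neg]
  linarith

theorem bddAbove_range_sum_add {ι H : Type*} {a : ι → H → ℝ} {C : ℝ}
    (ha : ∀ i h, |a i h| ≤ C) (s : Finset ι) (e : ι → ℝ) {v : H → ℝ} {K : ℝ}
    (hv : ∀ h, v h ≤ K) :
    BddAbove (Set.range fun h => (∑ j ∈ s, e j * a j h) + v h) := by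
  refine ⟨(∑ j ∈ s, |e j| * C) + K, ?_⟩
  rintro _ ⟨h, rfl⟩
  refine add_le_add (Finset.sum_le_sum fun j _ => ?_) (hv h)
  refine (le_abs_self _).trans ?_
  rw [abs_mul]
  exact mul_le_mul_of_nonneg_left (ha j h) (abs_nonneg _)

theorem bddAbove_range_sum_sub {ι H : Type*} {a : ι → H → ℝ} {C : ℝ}
    (ha : ∀ i h, |a i h| ≤ C) (s : Finset ι) (e : ι → ℝ) {v : H → ℝ} {K : ℝ}
    (hv : ∀ h, |v h| ≤ K) :
    BddAbove (Set.range fun h => (∑ j ∈ s, e j * a j h) - v h) := by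
  simp_rw [sub_eq_add_neg]
  exact bddAbove_range_sum_add ha s e (v := fun h => -v h) fun h => by
    linarith [(abs_le.1 (hv h)).1]

/-- One step of the contraction principle. -/
theorem rademacherSum_update_le_update {ι H : Type*} [Fintype ι] [DecidableEq ι] [Nonempty H]
    {a : ι → H → ℝ} {C K : ℝ} (ha : ∀ i h, |a i h| ≤ C) (i : ι) {u v : H → ℝ}
    (hv : ∀ h, |v h| ≤ K) (huv : ∀ h h', |u h - u h'| ≤ |v h - v h'|) :
    rademacherSum (Function.update a i u) ≤ rademacherSum (Function.update a i v) := by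
  have := rademacherSum_update_le_of_pair a i u v 0 fun σ => by
    rw [add_zero]
    refine ciSup_add_ciSup_le_of_forall fun h h' => ?_
    have b1 := bddAbove_range_sum_add ha (Finset.univ.erase i) (fun j => ((σ j : ℤ) : ℝ))
      (v := v) fun h => (le_abs_self _).trans (hv h)
    have b2 := bddAbove_range_sum_sub ha (Finset.univ.erase i) (fun j => ((σ j : ℤ) : ℝ)) hv
    have e1 := le_ciSup b1 h
    have e2 := le_ciSup b2 h'
    have e3 := le_ciSup b1 h'
    have e4 := le_ciSup b2 h
    have e5 := (le_abs_self _).trans (huv h h')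
    -- According to the sign of `v h - v h'`, the pair `(h, h')` or the swapped pair is tested in
    -- the two suprema; the sum over the other coordinates is symmetric in the pair.
    rcases abs_cases (v h - v h') with ⟨h0, _⟩ | ⟨h0, _⟩ <;> rw [h0] at e5 <;> linarith
  simpa using this

/-- Changing one nonnegative coordinate, bounded by `c`, changes `rademacherSum` by at most
`c / 2`. -/
theorem rademacherSum_update_le_update_add {ι H : Type*} [Fintype ι] [DecidableEq ι] [Nonempty H]
    {a : ι → H → ℝ} {C c : ℝ} (ha : ∀ i h, |a i h| ≤ C) (i : ι) {u v : H → ℝ}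
    (hu : ∀ h, u h ∈ Set.Icc 0 c) (hv : ∀ h, v h ∈ Set.Icc 0 c) :
    rademacherSum (Function.update a i u) ≤ rademacherSum (Function.update a i v) + c / 2 := by
  have hv' : ∀ h, |v h| ≤ c := fun h => by
    rw [abs_of_nonneg (hv h).1]; exact (hv h).2
  refine rademacherSum_update_le_of_pair a i u v c fun σ => ?_
  refine ciSup_add_ciSup_le_of_forall fun h h' => ?_
  have b1 := bddAbove_range_sum_add ha (Finset.univ.erase i) (fun j => ((σ j : ℤ) : ℝ))
    (v := v) fun h => (hv h).2
  have b2 := bddAbove_range_sum_sub ha (Finset.univ.erase i) (fun j => ((σ j : ℤ) : ℝ)) hv'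
  have e1 := le_ciSup b1 h
  have e2 := le_ciSup b2 h'
  have e3 := le_ciSup b1 h'
  have e4 := le_ciSup b2 h
  -- In half the sum of `e1` to `e4` the values of `v` cancel, and `u h - u h' ≤ c`.
  linarith [(hu h).1, (hu h).2, (hu h').1, (hu h').2]

/-- **Contraction principle** for Rademacher averages. -/
theorem rademacherSum_le_of_abs_sub_le {ι H : Type*} [Fintype ι] [DecidableEq ι] [Nonempty H]
    {a b : ι → H → ℝ} {C : ℝ} (ha : ∀ i h, |a i h| ≤ C) (hb : ∀ i h, |b i h| ≤ C)
    (hab : ∀ i h h', |a i h - a i h'| ≤ |b i h - b i h'|) :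
    rademacherSum a ≤ rademacherSum b := by
  -- The coordinates of `a` are replaced by those of `b` one at a time.
  suffices h : ∀ s : Finset ι, rademacherSum a ≤ rademacherSum (s.piecewise b a) by
    simpa using h Finset.univ
  intro s
  induction s using Finset.induction_on with
  | empty => simp
  | insert i s hi ih =>
    refine ih.trans ?_
    rw [Finset.piecewise_insert]
    conv_lhs => rw [← Function.update_eq_self i (s.piecewise b a)]
    refine rademacherSum_update_le_update (C := C) (fun j h => ?_) i (hb i) ?_
    · by_cases hj : j ∈ s <;> simp [hj, ha, hb]
    · simpa [hi] using hab i

theorem rademacherSum_nonneg {ι H : Type*} [Fintype ι] [DecidableEq ι] [Nonempty H]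
    {a : ι → H → ℝ} {C : ℝ} (ha : ∀ i h, |a i h| ≤ C) : 0 ≤ rademacherSum a := by
  have h0 : rademacherSum (fun (_ : ι) (_ : H) => (0 : ℝ)) = 0 := by simp [rademacherSum]
  rw [← h0]
  exact rademacherSum_le_of_abs_sub_le (C := C)
    (fun i h => by simpa using (abs_nonneg _).trans (ha i h)) ha (by simp)

theorem rademacherSum_const_mul {ι H : Type*} [Fintype ι] [DecidableEq ι]
    (a : ι → H → ℝ) {c : ℝ} (hc : 0 ≤ c) :
    rademacherSum (fun i h => c * a i h) = c * rademacherSum a := by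
  unfold rademacherSum
  rw [Finset.mul_expect]
  refine Finset.expect_congr rfl fun σ _ => ?_
  rw [Real.mul_iSup_of_nonneg hc]
  simp_rw [Finset.mul_sum]
  congr! 3
  ring

/-- Signs at coordinates where the family vanishes can be dropped. -/
theorem rademacherSum_ite_mem {ι H : Type*} [Fintype ι] [DecidableEq ι]
    (a : ι → H → ℝ) (T : Finset ι) :
    rademacherSum (fun i h => if i ∈ T then a i h else 0) =
      rademacherSum (fun (i : ↥T) h => a i h) := by
  unfold rademacherSum
  -- Signs split into those on `T` and those off `T`; the latter do not occur in the sum and average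
  -- out.
  rw [Fintype.expect_equiv (Equiv.piEquivPiSubtypeProd (fun i => i ∈ T) (fun _ => ℤˣ)) _
    (fun τ => ⨆ h, ∑ i : ↥T, ((τ.1 i : ℤ) : ℝ) * a i h)]
  · rw [← Finset.univ_product_univ, Finset.expect_product]
    simp
  · intro σ
    congr! 2 with h
    simp only [mul_ite, mul_zero, Finset.sum_ite_mem, Finset.univ_inter]
    rw [← Finset.sum_coe_sort]
    rfl

/-! ### Weighted Rademacher sums by Abel summation -/

/-- Abel summation, used in both directions: to unfold sorted weights into layers, and to fold the
layer bounds `√(k + 1)` back into increments of the square root. -/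
theorem sum_range_mul_eq_sum_sub_mul (q w : ℕ → ℝ) (m : ℕ) :
    ∑ k ∈ Finset.range m, q k * w k =
      ∑ k ∈ Finset.range m, (q k - q (k + 1)) * ∑ j ∈ Finset.range (k + 1), w j
        + q m * ∑ j ∈ Finset.range m, w j := by
  induction m with
  | zero => simp
  | succ m ih =>
    rw [Finset.sum_range_succ, ih, Finset.sum_range_succ _ m, Finset.sum_range_succ w m]
    ring

/-- An Abel-summed weighted sum of square roots is at most the `ℓ²` norm times a logarithm. -/
theorem sum_sub_mul_sqrt_le {q : ℕ → ℝ} {m : ℕ} (hqm : q m = 0) :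
    ∑ k ∈ Finset.range m, (q k - q (k + 1)) * √((k + 1 : ℕ) : ℝ) ≤
      √(∑ k ∈ Finset.range m, q k ^ 2) * (Real.log m + 1) := by
  have hlog : 0 ≤ Real.log m := Real.log_natCast_nonneg m
  have hsq : ∀ k : ℕ, ∑ j ∈ Finset.range k, (√((j + 1 : ℕ) : ℝ) - √(j : ℝ)) = √(k : ℝ) := by
    intro k
    rw [Finset.sum_range_sub (fun j : ℕ => √(j : ℝ))]
    simp
  have h1 := sum_range_mul_eq_sum_sub_mul q (fun j => √((j + 1 : ℕ) : ℝ) - √(j : ℝ)) m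
  simp only [hsq, hqm, zero_mul, add_zero] at h1
  rw [← h1]
  -- Cauchy–Schwarz separates the weights from the increments `√(k + 1) - √k`.
  refine (Real.sum_mul_le_sqrt_mul_sqrt _ _ _).trans ?_
  gcongr
  have h2 : ∑ k ∈ Finset.range m, (√((k + 1 : ℕ) : ℝ) - √(k : ℝ)) ^ 2 ≤ Real.log m + 1 := by
    have h3 : ((harmonic m : ℚ) : ℝ) ≤ 1 + Real.log m := harmonic_le_one_add_log m
    rw [add_comm]
    refine le_trans ?_ h3
    unfold harmonic
    push_cast
    refine Finset.sum_le_sum fun k _ => ?_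
    have ha : 0 ≤ √(k : ℝ) := Real.sqrt_nonneg _
    have hb : 0 < √((k : ℝ) + 1) := Real.sqrt_pos.2 (by positivity)
    have ha2 : √(k : ℝ) ^ 2 = k := Real.sq_sqrt (by positivity)
    have hb2 : √((k : ℝ) + 1) ^ 2 = k + 1 := Real.sq_sqrt (by positivity)
    have hle : √(k : ℝ) ≤ √((k : ℝ) + 1) := Real.sqrt_le_sqrt (by linarith)
    generalize √(k : ℝ) = r at *
    generalize √((k : ℝ) + 1) = s at *
    rw [← hb2, ← inv_pow]
    -- With `s = √(k + 1)` and `r = √k`, `s (s - r) = s² - r s ≤ s² - r² = 1`, so the squared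
    -- increment is at most `1 / (k + 1)`.
    refine pow_le_pow_left₀ (by linarith) ?_ 2
    rw [← one_div, le_div_iff₀ hb]
    nlinarith
  -- The square root of `log m + 1` is bounded by `log m + 1` itself, which is at least `1`.
  refine Real.sqrt_le_iff.2 ⟨by linarith, h2.trans ?_⟩
  nlinarith

/-- Every weight vector on `Fin m` is a relabelled nonincreasing sequence vanishing from `m` on. -/
theorem exists_equiv_antitone {m : ℕ} {p : Fin m → ℝ} (hp : ∀ i, 0 ≤ p i) :
    ∃ (e : Equiv.Perm (Fin m)) (q : ℕ → ℝ), (∀ k, q (k + 1) ≤ q k) ∧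
      q m = 0 ∧ ∀ j : Fin m, q j = p (e j) := by
  let e := Tuple.sort (fun i => -p i)
  have he : Monotone ((fun i => -p i) ∘ e) := Tuple.monotone_sort _
  refine ⟨e, fun k => if h : k < m then p (e ⟨k, h⟩) else 0, fun k => ?_, by simp,
    fun j => by simp⟩
  dsimp only
  split_ifs with h1 h2
  · have := @he ⟨k, h2⟩ ⟨k + 1, h1⟩ (by simp [Fin.le_def])
    simpa using this
  · omega
  · exact hp _
  · exact le_rfl

/-- Weighted Rademacher averages are controlled by the Rademacher averages over subsamples, up to
the `ℓ²` norm of the weights and a logarithm. -/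
theorem rademacherSum_weighted_le {H : Type*} [Nonempty H] {m : ℕ}
    {a : Fin m → H → ℝ} {C K : ℝ} (ha : ∀ i h, |a i h| ≤ C) (hK : 0 ≤ K)
    (hT : ∀ T : Finset (Fin m), T.Nonempty →
      rademacherSum (fun (i : ↥T) h => a i h) ≤ K * √(T.card : ℝ))
    {p : Fin m → ℝ} (hp : ∀ i, 0 ≤ p i) :
    rademacherSum (fun i h => p i * a i h) ≤ K * (√(∑ i, p i ^ 2) * (Real.log m + 1)) := by
  obtain ⟨e, q, hqa, hqm, hqp⟩ := exists_equiv_antitone hp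
  -- `T k` holds the indices of the `k` largest weights, ties being broken by `e`.
  let T : ℕ → Finset (Fin m) := fun k => (Finset.univ.filter fun j : Fin m => (j : ℕ) < k).map
    e.toEmbedding
  have hTsum : ∀ k ≤ m, ∀ w : Fin m → ℝ, ∑ i ∈ T k, w i =
      ∑ j ∈ Finset.range k, if h : j < m then w (e ⟨j, h⟩) else 0 := by
    intro k hk w
    rw [Finset.sum_map]
    refine Finset.sum_bij (fun j _ => (j : ℕ)) ?_ ?_ ?_ ?_
    · intro j hj; simpa using hj
    · intro j _ j' _ h; exact Fin.ext h
    · intro j hj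
      exact ⟨⟨j, (Finset.mem_range.1 hj).trans_le hk⟩, by simpa using hj, rfl⟩
    · intro j _; simp
  have hTcard : ∀ k ≤ m, (T k).card = k := by
    intro k hk
    have := hTsum k hk (fun _ => 1)
    have h2 : ∀ j ∈ Finset.range k, (if h : j < m then (1 : ℝ) else 0) = 1 := fun j hj => by
      simp [(Finset.mem_range.1 hj).trans_le hk]
    rw [Finset.sum_congr rfl h2] at this
    simp only [Finset.sum_const, nsmul_eq_mul, mul_one, Finset.card_range] at this
    exact_mod_cast this
  have hTm : T m = Finset.univ := Finset.eq_univ_of_card _ (by simp [hTcard m le_rfl])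
  -- Layer decomposition: the weights are a combination of indicators of the `T (k + 1)` with
  -- nonnegative coefficients. No boundary term remains because `q m = 0`.
  have hdecomp : ∀ w : Fin m → ℝ, ∑ i, p i * w i =
      ∑ k ∈ Finset.range m, (q k - q (k + 1)) * ∑ i ∈ T (k + 1), w i := by
    intro w
    have h1 := sum_range_mul_eq_sum_sub_mul q (fun j => if h : j < m then w (e ⟨j, h⟩) else 0) m
    rw [hqm, zero_mul, add_zero] at h1
    rw [← hTm, hTsum m le_rfl]
    refine Eq.trans (Finset.sum_congr rfl fun j hj => ?_) (h1.trans ?_)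
    · have hj' := Finset.mem_range.1 hj
      have := hqp ⟨j, hj'⟩
      simp only at this
      simp [hj', this]
    · refine Finset.sum_congr rfl fun k hk => ?_
      rw [hTsum (k + 1) (Finset.mem_range.1 hk)]
  have hpq : ∑ i, p i ^ 2 = ∑ k ∈ Finset.range m, q k ^ 2 := by
    rw [← hTm, hTsum m le_rfl]
    refine Finset.sum_congr rfl fun j hj => ?_
    have hj' := Finset.mem_range.1 hj
    have := hqp ⟨j, hj'⟩
    simp only at this
    simp [hj', this]
  have hC : ∀ T : Finset (Fin m), ∀ i h, |if i ∈ T then a i h else 0| ≤ C := by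
    intro T i h
    split_ifs
    · exact ha i h
    · simpa using (abs_nonneg _).trans (ha i h)
  calc rademacherSum (fun i h => p i * a i h)
      ≤ ∑ k ∈ Finset.range m, (q k - q (k + 1)) *
          rademacherSum (fun i h => if i ∈ T (k + 1) then a i h else 0) := by
        unfold rademacherSum
        simp_rw [Finset.mul_expect]
        rw [← Finset.expect_sum_comm]
        refine Finset.expect_le_expect fun σ _ => ciSup_le fun h => ?_
        have : ∑ i, ((σ i : ℤ) : ℝ) * (p i * a i h) = ∑ i, p i * (((σ i : ℤ) : ℝ) * a i h) :=
          Finset.sum_congr rfl fun i _ => by ring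
        rw [this, hdecomp]
        refine Finset.sum_le_sum fun k _ =>
          mul_le_mul_of_nonneg_left ?_ (sub_nonneg.2 (hqa k))
        have hb := bddAbove_range_sum_mul (hC (T (k + 1))) (fun i => ((σ i : ℤ) : ℝ))
        refine le_trans (le_of_eq ?_) (le_ciSup hb h)
        simp
    _ ≤ ∑ k ∈ Finset.range m, (q k - q (k + 1)) * (K * √((k + 1 : ℕ) : ℝ)) := by
        refine Finset.sum_le_sum fun k hk =>
          mul_le_mul_of_nonneg_left ?_ (sub_nonneg.2 (hqa k))
        have hc := hTcard (k + 1) (Finset.mem_range.1 hk)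
        have hle := hT (T (k + 1)) (Finset.card_pos.1 (by omega))
        rwa [hc, ← rademacherSum_ite_mem a] at hle
    _ = K * ∑ k ∈ Finset.range m, (q k - q (k + 1)) * √((k + 1 : ℕ) : ℝ) := by
        rw [Finset.mul_sum]; exact Finset.sum_congr rfl fun k _ => by ring
    _ ≤ _ := by
        rw [hpq]
        exact mul_le_mul_of_nonneg_left (sum_sub_mul_sqrt_le hqm) hK

/-! ### Concentration: Hoeffding's lemma and McDiarmid's inequality -/

theorem integrable_of_abs_le {Ω : Type*} [MeasurableSpace Ω] {P : Measure Ω} [IsFiniteMeasure P]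
    {f : Ω → ℝ} {C : ℝ} (hf : Measurable f) (hC : ∀ x, |f x| ≤ C) : Integrable f P :=
  Integrable.of_bound hf.aestronglyMeasurable C (ae_of_all _ hC)

theorem abs_integral_le_of_abs_le {Ω : Type*} [MeasurableSpace Ω] {P : Measure Ω}
    [IsProbabilityMeasure P] {f : Ω → ℝ} {C : ℝ} (hC : ∀ x, |f x| ≤ C) : |∫ x, f x ∂P| ≤ C := by
  simpa using norm_integral_le_of_norm_le_const (μ := P) (f := f) (ae_of_all _ hC)

theorem integrable_exp_mul_of_abs_le {Ω : Type*} [MeasurableSpace Ω] {P : Measure Ω}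
    [IsFiniteMeasure P] {f : Ω → ℝ} {C : ℝ} (hf : Measurable f) (hC : ∀ x, |f x| ≤ C) (t : ℝ) :
    Integrable (fun x => Real.exp (t * f x)) P := by
  refine integrable_of_abs_le (C := Real.exp (|t| * C)) (by fun_prop) fun x => ?_
  rw [abs_of_pos (Real.exp_pos _), Real.exp_le_exp]
  refine (le_abs_self _).trans ?_
  rw [abs_mul]
  exact mul_le_mul_of_nonneg_left (hC x) (abs_nonneg t)

/-- Hoeffding's lemma for a function with oscillation at most `d`. -/
theorem hasSubgaussianMGF_of_sub_le {Z : Type*} [MeasurableSpace Z] {D : Measure Z}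
    [IsProbabilityMeasure D] {f : Z → ℝ} (hf : Measurable f) {d : NNReal}
    (hd : ∀ z z', f z - f z' ≤ d) :
    HasSubgaussianMGF (fun z => f z - ∫ z, f z ∂D) ((d / 2) ^ 2) D := by
  have : Nonempty Z := nonempty_of_isProbabilityMeasure D
  have hb : BddBelow (Set.range f) := by
    obtain ⟨z0⟩ := this
    exact ⟨f z0 - d, by rintro _ ⟨z, rfl⟩; linarith [hd z0 z]⟩
  have h := hasSubgaussianMGF_of_mem_Icc (μ := D) (a := ⨅ z, f z) (b := (⨅ z, f z) + d)
    hf.aemeasurable (ae_of_all _ fun z => ⟨ciInf_le hb z, by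
      have : f z - d ≤ ⨅ z, f z := le_ciInf fun z' => by linarith [hd z z']
      linarith⟩)
  simpa using h

/-- **McDiarmid's inequality**, as a sub-Gaussian bound for functions of i.i.d. variables with
bounded differences. -/
theorem hasSubgaussianMGF_of_bounded_differences {Z : Type*} [MeasurableSpace Z] (D : Measure Z)
    [IsProbabilityMeasure D] (d : NNReal) (n : ℕ) :
    ∀ {f : (Fin n → Z) → ℝ} {C : ℝ}, Measurable f → (∀ s, |f s| ≤ C) →
      (∀ s i z, f (Function.update s i z) - f s ≤ d) →
      HasSubgaussianMGF (fun s => f s - ∫ s, f s ∂Measure.pi fun _ => D) (n * (d / 2) ^ 2)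
        (Measure.pi fun _ => D) := by
  induction n with
  | zero =>
    intro f C hf hC hd
    have h0 : ∀ s, f s = f Fin.elim0 := fun s => by rw [Subsingleton.elim s]
    simp_rw [h0]
    simp
  | succ n ih =>
    intro f C hf hC hd
    set P := Measure.pi fun _ : Fin n => D
    have hcons : Measurable fun w : Z × (Fin n → Z) => (Fin.cons w.1 w.2 : Fin (n + 1) → Z) := by
      refine measurable_pi_iff.2 fun i => ?_
      refine Fin.cases ?_ (fun j => ?_) i
      · simpa using measurable_fst
      · simpa [Function.comp_def] using (measurable_pi_apply j).comp measurable_snd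
    have hmp : MeasurePreserving
        (fun w : Z × (Fin n → Z) => (Fin.cons w.1 w.2 : Fin (n + 1) → Z))
        (D.prod P) (Measure.pi fun _ : Fin (n + 1) => D) := by
      convert (measurePreserving_piFinSuccAbove (fun _ : Fin (n + 1) => D) 0).symm using 1
      ext w i
      simp [MeasurableEquiv.piFinSuccAbove, Fin.insertNthEquiv]
    have hint : ∀ F : (Fin (n + 1) → Z) → ℝ, Measurable F →
        Integrable F (Measure.pi fun _ : Fin (n + 1) => D) →
        ∫ s, F s ∂(Measure.pi fun _ : Fin (n + 1) => D) =
          ∫ s, ∫ z, F (Fin.cons z s) ∂D ∂P := by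
      intro F hF hFi
      rw [← hmp.map_eq, integral_map hcons.aemeasurable hF.aestronglyMeasurable]
      exact integral_prod_symm _ (hmp.integrable_comp_of_integrable hFi)
    -- Averaging out the first coordinate keeps the difference bound `d`. In `f - E f = (f - h) + (h
    -- - E h)`, Hoeffding's lemma treats the first term for fixed `s`, and induction the second.
    let h : (Fin n → Z) → ℝ := fun s => ∫ z, f (Fin.cons z s) ∂D
    have hhm : Measurable h := by
      have : StronglyMeasurable (fun w : (Fin n → Z) × Z => f (Fin.cons w.2 w.1)) :=
        (hf.comp (hcons.comp measurable_swap)).stronglyMeasurable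
      exact this.integral_prod_right.measurable
    have hsec : ∀ s, Measurable fun z => f (Fin.cons z s) := fun s =>
      hf.comp (hcons.comp measurable_prodMk_right)
    have hseci : ∀ s, Integrable (fun z => f (Fin.cons z s)) D := fun s =>
      integrable_of_abs_le (hsec s) fun z => hC _
    have hhC : ∀ s, |h s| ≤ C := fun s => abs_integral_le_of_abs_le fun z => hC _
    have hhd : ∀ s i z, h (Function.update s i z) - h s ≤ d := by
      intro s i z
      simp only [h]
      rw [← integral_sub (hseci _) (hseci _)]
      have : ∀ z', f (Fin.cons z' (Function.update s i z)) - f (Fin.cons z' s) ≤ d := by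
        intro z'
        have := hd (Fin.cons z' s) i.succ z
        rwa [← Fin.cons_update] at this
      calc _ ≤ ∫ _, (d : ℝ) ∂D :=
            integral_mono ((hseci _).sub (hseci _)) (integrable_const _) this
        _ = d := by simp
    have hE : ∫ s, f s ∂(Measure.pi fun _ : Fin (n + 1) => D) = ∫ s, h s ∂P :=
      hint f hf (integrable_of_abs_le hf hC)
    have hbound : ∀ s, |f s - ∫ s, f s ∂(Measure.pi fun _ : Fin (n + 1) => D)| ≤
        C + |∫ s, f s ∂(Measure.pi fun _ : Fin (n + 1) => D)| := fun s =>
      (abs_sub _ _).trans (by linarith [hC s])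
    have hexp : ∀ t, Integrable (fun s =>
        Real.exp (t * (f s - ∫ s, f s ∂(Measure.pi fun _ : Fin (n + 1) => D))))
        (Measure.pi fun _ : Fin (n + 1) => D) := fun t =>
      integrable_exp_mul_of_abs_le (hf.sub_const _) hbound t
    refine ⟨hexp, fun t => ?_⟩
    have ihh := ih hhm hhC hhd
    have hoef : ∀ s, HasSubgaussianMGF (fun z => f (Fin.cons z s) - h s) ((d / 2) ^ 2) D := by
      intro s
      refine hasSubgaussianMGF_of_sub_le (hsec s) fun z z' => ?_
      have := hd (Fin.cons z' s) 0 z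
      rwa [Fin.update_cons_zero] at this
    rw [mgf, hint _ (by fun_prop) (hexp t)]
    have hle : ∀ s, ∫ z, Real.exp (t * (f (Fin.cons z s) -
        ∫ s, f s ∂(Measure.pi fun _ : Fin (n + 1) => D))) ∂D ≤
        Real.exp (((d / 2) ^ 2 : NNReal) * t ^ 2 / 2) * Real.exp (t * (h s - ∫ s, h s ∂P)) := by
      intro s
      have : ∀ z, Real.exp (t * (f (Fin.cons z s) -
          ∫ s, f s ∂(Measure.pi fun _ : Fin (n + 1) => D))) =
          Real.exp (t * (f (Fin.cons z s) - h s)) * Real.exp (t * (h s - ∫ s, h s ∂P)) := by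
        intro z
        rw [hE, ← Real.exp_add]
        congr 1; ring
      simp_rw [this]
      rw [integral_mul_const]
      exact mul_le_mul_of_nonneg_right ((hoef s).mgf_le t) (Real.exp_pos _).le
    calc _ ≤ ∫ s, Real.exp (((d / 2) ^ 2 : NNReal) * t ^ 2 / 2) *
            Real.exp (t * (h s - ∫ s, h s ∂P)) ∂P := by
          refine integral_mono_of_nonneg (ae_of_all _ fun s => ?_)
            ((ihh.integrable_exp_mul t).const_mul _) (ae_of_all _ hle)
          exact integral_nonneg fun z => (Real.exp_pos _).le
      _ ≤ Real.exp (((d / 2) ^ 2 : NNReal) * t ^ 2 / 2) *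
            Real.exp ((n * (d / 2) ^ 2 : NNReal) * t ^ 2 / 2) := by
          rw [integral_const_mul]
          exact mul_le_mul_of_nonneg_left (ihh.mgf_le t) (Real.exp_pos _).le
      _ = _ := by
          rw [← Real.exp_add]
          congr 1
          push_cast
          ring

theorem integral_expect {Ω κ : Type*} [MeasurableSpace Ω] {P : Measure Ω} [Fintype κ]
    {F : κ → Ω → ℝ} (hF : ∀ k, Integrable (F k) P) :
    ∫ s, (𝔼 k, F k s) ∂P = 𝔼 k, ∫ s, F k s ∂P := by
  simp_rw [Fintype.expect_eq_sum_div_card]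
  rw [integral_div, integral_finsetSum _ fun k _ => hF k]

/-! ### Symmetrization and uniform deviation -/

section Symmetrization

variable {Z H : Type*} [MeasurableSpace Z]

/-- Exchanging a subset of the coordinates of a sample and an independent copy of it preserves
their joint law. -/
theorem measurePreserving_swap_signs {m : ℕ} (D : Measure Z) [IsProbabilityMeasure D]
    (σ : Fin m → ℤˣ) :
    MeasurePreserving
      (fun w : (Fin m → Z) × (Fin m → Z) =>
        ((fun i => if σ i = 1 then w.1 i else w.2 i),
          (fun i => if σ i = 1 then w.2 i else w.1 i)))
      ((Measure.pi fun _ => D).prod (Measure.pi fun _ => D))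
      ((Measure.pi fun _ => D).prod (Measure.pi fun _ => D)) := by
  -- Viewed as one sample of pairs, the exchange acts coordinatewise by the identity or by
  -- `Prod.swap`.
  have hE := measurePreserving_arrowProdEquivProdArrow Z Z (Fin m) (fun _ => D) (fun _ => D)
  have hS : MeasurePreserving
      (fun (w : Fin m → Z × Z) i => (if σ i = 1 then id else Prod.swap : Z × Z → Z × Z) (w i))
      (.pi fun _ => D.prod D) (.pi fun _ => D.prod D) := by
    refine measurePreserving_pi _ _ fun i => ?_
    split_ifs
    · exact MeasurePreserving.id _
    · exact Measure.measurePreserving_swap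
  convert hE.comp (hS.comp (hE.symm _)) using 1
  ext w i
  · by_cases h : σ i = 1 <;>
      simp [h, MeasurableEquiv.arrowProdEquivProdArrow, Equiv.arrowProdEquivProdArrow]
  · by_cases h : σ i = 1 <;>
      simp [h, MeasurableEquiv.arrowProdEquivProdArrow, Equiv.arrowProdEquivProdArrow]

theorem abs_iSup_le_of_forall [Nonempty H] {f : H → ℝ} {C : ℝ} (h : ∀ x, |f x| ≤ C) : |⨆ x, f x| ≤ C := by
  let x0 := Classical.arbitrary H
  rw [abs_le]
  exact ⟨(abs_le.1 (h x0)).1.trans (le_ciSup ⟨C, by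
    rintro _ ⟨x, rfl⟩; exact (le_abs_self _).trans (h x)⟩ x0),
    ciSup_le fun x => (le_abs_self _).trans (h x)⟩

variable {D : Measure Z} {l : H → Z → ℝ} {C : ℝ}

theorem measurable_iSup_sum_mul
    (hmeas : ∀ (n : ℕ) (e : Fin n → ℝ) (c : ℝ), Measurable fun s : Fin n → Z =>
      ⨆ h, (∑ i, e i * l h (s i) + c * ∫ z, l h z ∂D)) {n : ℕ} (e : Fin n → ℝ) :
    Measurable fun s : Fin n → Z => ⨆ h, ∑ i, e i * l h (s i) := by
  simpa using hmeas n e 0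

/-- **Symmetrization**: the expected uniform deviation of empirical sums from their means is at
most twice the expected Rademacher sum. -/
theorem integral_iSup_deviation_le [Nonempty H] [IsProbabilityMeasure D]
    (hl : ∀ h, Measurable (l h)) (hC : ∀ h z, |l h z| ≤ C)
    (hmeas : ∀ (n : ℕ) (e : Fin n → ℝ) (c : ℝ), Measurable fun s : Fin n → Z =>
      ⨆ h, (∑ i, e i * l h (s i) + c * ∫ z, l h z ∂D)) (m : ℕ) :
    ∫ s : Fin m → Z, ⨆ h, (∑ i, (-1) * l h (s i) + m * ∫ z, l h z ∂D) ∂(Measure.pi fun _ => D) ≤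
      2 * ∫ s : Fin m → Z, rademacherSum (fun i h => l h (s i)) ∂(Measure.pi fun _ => D) := by
  set P := Measure.pi fun _ : Fin m => D
  let A : (Fin m → ℤˣ) → (Fin m → Z) → ℝ := fun σ s => ⨆ h, ∑ i, ((σ i : ℤ) : ℝ) * l h (s i)
  let J : (Fin m → ℤˣ) → (Fin m → Z) × (Fin m → Z) → ℝ := fun σ w =>
    ⨆ h, ∑ i, ((σ i : ℤ) : ℝ) * (l h (w.2 i) - l h (w.1 i))
  have habs : ∀ σ : ℤˣ, |((σ : ℤ) : ℝ)| = 1 := fun σ => by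
    rcases Int.units_eq_one_or σ with h | h <;> simp [h]
  have hsum : ∀ (σ : Fin m → ℤˣ) (v : Fin m → ℝ) (K : ℝ), (∀ i, |v i| ≤ K) →
      |∑ i, ((σ i : ℤ) : ℝ) * v i| ≤ m * K := by
    intro σ v K hv
    refine (Finset.abs_sum_le_sum_abs _ _).trans ?_
    refine (Finset.sum_le_sum (g := fun _ => K) fun i _ => ?_).trans (by simp)
    rw [abs_mul, habs, one_mul]
    exact hv i
  have hAm : ∀ σ, Measurable (A σ) := fun σ => measurable_iSup_sum_mul hmeas _
  have hAC : ∀ σ s, |A σ s| ≤ m * C := fun σ s =>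
    abs_iSup_le_of_forall fun h => hsum σ _ C fun i => hC h _
  have hAi : ∀ σ, Integrable (A σ) P := fun σ => integrable_of_abs_le (hAm σ) (hAC σ)
  have hJb : ∀ (σ : Fin m → ℤˣ) (w : (Fin m → Z) × (Fin m → Z)) (h : H), |∑ i, ((σ i : ℤ) : ℝ) * (l h (w.2 i) - l h (w.1 i))| ≤ m * (C + C) :=
    fun σ w h => hsum σ _ _ fun i => (abs_sub _ _).trans (add_le_add (hC _ _) (hC _ _))
  have hJbdd : ∀ (σ : Fin m → ℤˣ) (w : (Fin m → Z) × (Fin m → Z)), BddAbove (Set.range fun h =>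
      ∑ i, ((σ i : ℤ) : ℝ) * (l h (w.2 i) - l h (w.1 i))) := fun σ w =>
    ⟨m * (C + C), by rintro _ ⟨h, rfl⟩; exact (le_abs_self _).trans (hJb σ w h)⟩
  have hJm : ∀ σ, Measurable (J σ) := by
    intro σ
    -- A signed difference over two samples is a linear combination of losses over one sample of
    -- size `m + m`, so the assumed measurability applies.
    have h1 := measurable_iSup_sum_mul hmeas (n := m + m)
      (Fin.append (fun i => ((σ i : ℤ) : ℝ)) (fun i => -((σ i : ℤ) : ℝ)))
    have h2 : Measurable fun w : (Fin m → Z) × (Fin m → Z) => Fin.append w.2 w.1 := by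
      refine measurable_pi_iff.2 fun i => ?_
      refine Fin.addCases (fun j => ?_) (fun j => ?_) i
      · simp only [Fin.append_left]; fun_prop
      · simp only [Fin.append_right]; fun_prop
    convert h1.comp h2 using 1
    ext w
    simp only [J, Function.comp, Fin.sum_univ_add, Fin.append_left, Fin.append_right]
    congr! 2 with h
    rw [← Finset.sum_add_distrib]
    exact Finset.sum_congr rfl fun i _ => by ring
  have hJC : ∀ σ w, |J σ w| ≤ m * (C + C) := fun σ w => abs_iSup_le_of_forall (hJb σ w)
  have hJi : ∀ σ, Integrable (J σ) (P.prod P) := fun σ => integrable_of_abs_le (hJm σ) (hJC σ)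
  have hlPi : ∀ h (i : Fin m), Integrable (fun s : Fin m → Z => l h (s i)) P := fun h i =>
    integrable_of_abs_le ((hl h).comp (measurable_pi_apply i)) fun s => hC h _
  have hlP : ∀ h (i : Fin m), ∫ s, l h (s i) ∂P = ∫ z, l h z ∂D := by
    intro h i
    have := (measurePreserving_eval (fun _ : Fin m => D) i)
    rw [← this.map_eq, integral_map (measurable_pi_apply i).aemeasurable
      (hl h).aestronglyMeasurable]
  -- The mean is replaced by an average over an independent ghost sample `s'`, and the supremum of
  -- the integral is at most the integral of the supremum.
  have hghost : ∀ s, (⨆ h, (∑ i, (-1) * l h (s i) + m * ∫ z, l h z ∂D)) ≤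
      ∫ s', J 1 (s, s') ∂P := by
    intro s
    refine ciSup_le fun h => ?_
    have h1 : ∑ i, (-1) * l h (s i) + m * ∫ z, l h z ∂D =
        ∫ s', ∑ i, (l h (s' i) - l h (s i)) ∂P := by
      rw [integral_finsetSum (f := fun i (s' : Fin m → Z) => l h (s' i) - l h (s i)) _
        fun i _ => (hlPi h i).sub (integrable_const _)]
      simp_rw [integral_sub (hlPi h _) (integrable_const _), hlP]
      simp
      ring
    rw [h1]
    refine integral_mono (integrable_finsetSum _ fun i _ => (hlPi h i).sub (integrable_const _))
      (integrable_of_abs_le ((hJm 1).comp measurable_prodMk_left) fun s' => hJC _ _) fun s' => ?_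
    refine le_trans (le_of_eq ?_) (le_ciSup (hJbdd 1 (s, s')) h)
    simp
  have hdev : ∫ s : Fin m → Z, ⨆ h, (∑ i, (-1) * l h (s i) + m * ∫ z, l h z ∂D) ∂P ≤
      ∫ w, J 1 w ∂(P.prod P) := by
    rw [integral_prod _ (hJi 1)]
    refine integral_mono (integrable_of_abs_le (C := m * C + m * C) (hmeas m _ _) fun s => ?_)
      (hJi 1).integral_prod_left hghost
    refine abs_iSup_le_of_forall fun h => (abs_add_le _ _).trans (add_le_add ?_ ?_)
    · simpa using hsum (-1) (fun i => l h (s i)) C fun i => hC h _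
    · rw [abs_mul, Nat.abs_cast]
      refine mul_le_mul_of_nonneg_left ?_ (Nat.cast_nonneg m)
      exact abs_integral_le_of_abs_le (hC h)
  -- Exchanging the `i`-th entries of the sample and its ghost copy flips the sign of the `i`-th
  -- difference.
  have hsym : ∀ σ, ∫ w, J 1 w ∂(P.prod P) = ∫ w, J σ w ∂(P.prod P) := by
    intro σ
    have hsw := measurePreserving_swap_signs (m := m) D σ
    rw [← hsw.map_eq, integral_map hsw.measurable.aemeasurable (hJm 1).aestronglyMeasurable,
      hsw.map_eq]
    congr! 2 with w
    simp only [J]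
    congr! 3 with h i
    rcases Int.units_eq_one_or (σ i) with hi | hi <;> simp [hi]
  have hsplit : ∀ σ, ∫ w, J σ w ∂(P.prod P) ≤ (∫ s, A σ s ∂P) + ∫ s, A (-σ) s ∂P := by
    intro σ
    have i1 : Integrable (fun w : (Fin m → Z) × (Fin m → Z) => A σ w.2) (P.prod P) :=
      integrable_of_abs_le ((hAm σ).comp measurable_snd) fun w => hAC _ _
    have i2 : Integrable (fun w : (Fin m → Z) × (Fin m → Z) => A (-σ) w.1) (P.prod P) :=
      integrable_of_abs_le ((hAm (-σ)).comp measurable_fst) fun w => hAC _ _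
    calc _ ≤ ∫ w, (A σ w.2 + A (-σ) w.1) ∂(P.prod P) := by
          refine integral_mono (hJi σ) (i1.add i2) fun w => ciSup_le fun h => ?_
          have b1 := le_ciSup (bddAbove_range_sum_mul (a := fun i h => l h (w.2 i))
            (fun i h => hC h _) (fun i => ((σ i : ℤ) : ℝ))) h
          have b2 := le_ciSup (bddAbove_range_sum_mul (a := fun i h => l h (w.1 i))
            (fun i h => hC h _) (fun i => (((-σ) i : ℤ) : ℝ))) h
          refine le_trans (le_of_eq ?_) (add_le_add b1 b2)
          simp only [Pi.neg_apply, Units.val_neg, Int.cast_neg]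
          rw [← Finset.sum_add_distrib]
          exact Finset.sum_congr rfl fun i _ => by ring
      _ = _ := by
          rw [integral_add i1 i2, integral_fun_snd (A σ), integral_fun_fst (A (-σ))]
          simp
  have hneg : 𝔼 σ : Fin m → ℤˣ, ∫ s, A (-σ) s ∂P = 𝔼 σ : Fin m → ℤˣ, ∫ s, A σ s ∂P :=
    Fintype.expect_bijective _ neg_involutive.bijective _ _ fun _ => rfl
  have hR : ∫ s : Fin m → Z, rademacherSum (fun i h => l h (s i)) ∂P =
      𝔼 σ : Fin m → ℤˣ, ∫ s, A σ s ∂P := integral_expect hAi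
  calc _ ≤ 𝔼 σ : Fin m → ℤˣ, ((∫ s, A σ s ∂P) + ∫ s, A (-σ) s ∂P) := by
        rw [← Fintype.expect_const (ι := Fin m → ℤˣ) (∫ s : Fin m → Z, _ ∂P)]
        exact Finset.expect_le_expect fun σ _ =>
          hdev.trans ((hsym σ).le.trans (hsplit σ))
    _ = _ := by rw [Finset.expect_add_distrib, hneg, hR]; ring

/-- **Uniform deviation bound**: with high probability, uniformly over a class of `[0, b]`-valued
losses, the expected loss is at most the empirical one plus twice the Rademacher average plus a
deviation term. -/
theorem measure_uniform_deviation_le [Nonempty H] [IsProbabilityMeasure D] {b : ℝ}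
    (hl : ∀ h, Measurable (l h)) (hb : ∀ h z, l h z ∈ Set.Icc 0 b)
    (hmeas : ∀ (n : ℕ) (e : Fin n → ℝ) (c : ℝ), Measurable fun s : Fin n → Z =>
      ⨆ h, (∑ i, e i * l h (s i) + c * ∫ z, l h z ∂D)) (m : ℕ) {ε : ℝ} (hε : 0 ≤ ε) :
    Measure.pi (fun _ : Fin m => D)
      {S | ¬ ∀ h, m * ∫ z, l h z ∂D < ∑ i, l h (S i) +
        2 * rademacherSum (fun i h => l h (S i)) + ε} ≤
      ENNReal.ofReal (Real.exp (-ε ^ 2 / (2 * (m * b ^ 2)))) := by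
  set P := Measure.pi fun _ : Fin m => D
  have hne : Nonempty Z := nonempty_of_isProbabilityMeasure D
  have hb0 : 0 ≤ b := by
    obtain ⟨z⟩ := hne
    exact (hb (Classical.arbitrary H) z).1.trans (hb _ z).2
  have hC : ∀ h z, |l h z| ≤ b := fun h z => by
    rw [abs_of_nonneg (hb h z).1]; exact (hb h z).2
  let Φ : (Fin m → Z) → ℝ := fun s => ⨆ h, (∑ i, (-1) * l h (s i) + m * ∫ z, l h z ∂D)
  let R : (Fin m → Z) → ℝ := fun s => rademacherSum (fun i h => l h (s i))
  have hintC : ∀ h, |∫ z, l h z ∂D| ≤ b := fun h =>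
    abs_integral_le_of_abs_le (hC h)
  have hΦabs : ∀ (s : Fin m → Z) (h : H), |∑ i, (-1) * l h (s i) + m * ∫ z, l h z ∂D| ≤
      (∑ _ : Fin m, |(-1 : ℝ)|) * b + m * b := by
    intro s h
    refine (abs_add_le _ _).trans (add_le_add
      (abs_sum_mul_le (a := fun i h => l h (s i)) (fun i h => hC h _) (fun _ => -1) h) ?_)
    rw [abs_mul, Nat.abs_cast]
    exact mul_le_mul_of_nonneg_left (hintC h) (Nat.cast_nonneg m)
  have hΦbdd : ∀ s : Fin m → Z, BddAbove (Set.range fun h =>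
      (∑ i, (-1) * l h (s i) + m * ∫ z, l h z ∂D)) := fun s =>
    ⟨_, by rintro _ ⟨h, rfl⟩; exact (le_abs_self _).trans (hΦabs s h)⟩
  have hΦm : Measurable Φ := hmeas m _ _
  have hΦC : ∀ s, |Φ s| ≤ (∑ _ : Fin m, |(-1 : ℝ)|) * b + m * b := fun s =>
    abs_iSup_le_of_forall (hΦabs s)
  have hRm : Measurable R := by
    simp only [R, rademacherSum, Fintype.expect_eq_sum_div_card]
    exact (Finset.measurable_sum _ fun σ _ => measurable_iSup_sum_mul hmeas _).div_const _
  have hRu : ∀ s i z, |R (Function.update s i z) - R s| ≤ b / 2 := by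
    intro s i z
    have hu : ∀ w, (fun j h => l h (Function.update s i w j)) =
        Function.update (fun j h => l h (s j)) i (fun h => l h w) := by
      intro w
      ext j h
      by_cases hj : j = i
      · subst hj; simp
      · simp [hj]
    have key : ∀ w w', R (Function.update s i w) ≤ R (Function.update s i w') + b / 2 := by
      intro w w'
      simp only [R, hu]
      exact rademacherSum_update_le_update_add (C := b) (fun j h => hC h _) i
        (fun h => hb h w) (fun h => hb h w')
    have h1 := key z (s i)
    have h2 := key (s i) z
    rw [Function.update_eq_self] at h1 h2
    rw [abs_le]
    constructor <;> linarith
  have hR0 : ∀ s, 0 ≤ R s := fun s => rademacherSum_nonneg (C := b) fun i h => hC h _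
  have hRC : ∀ s, |R s| ≤ (∑ _ : Fin m, (1 : ℝ)) * b := by
    intro s
    rw [abs_of_nonneg (hR0 s)]
    refine Finset.expect_le Finset.univ_nonempty fun σ _ => ciSup_le fun h => ?_
    refine (le_abs_self _).trans ((abs_sum_mul_le (a := fun i h => l h (s i))
      (fun i h => hC h _) (fun i => ((σ i : ℤ) : ℝ)) h).trans (le_of_eq ?_))
    congr 1
    refine Finset.sum_congr rfl fun i _ => ?_
    rcases Int.units_eq_one_or (σ i) with h | h <;> simp [h]
  have hΦu : ∀ s i z, Φ (Function.update s i z) - Φ s ≤ b := by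
    intro s i z
    refine (le_abs_self _).trans (abs_ciSup_sub_ciSup_le (hΦbdd _) (hΦbdd _) fun h => ?_)
    have : ∑ j, (-1) * l h (Function.update s i z j) - ∑ j, (-1) * l h (s j) =
        l h (s i) - l h z := by
      rw [← Finset.sum_sub_distrib, Finset.sum_eq_single i]
      · simp; ring
      · intro j _ hj; simp [hj]
      · simp
    rw [add_sub_add_right_eq_sub, this, abs_le]
    constructor <;> linarith [(hb h z).1, (hb h z).2, (hb h (s i)).1, (hb h (s i)).2]
  -- Concentrating `Φ - 2R` in one stroke keeps the Rademacher term empirical without a second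
  -- failure event.
  have hE : ∫ s, (Φ s - 2 * R s) ∂P ≤ 0 := by
    rw [integral_sub (integrable_of_abs_le hΦm hΦC)
      ((integrable_of_abs_le hRm hRC).const_mul 2), integral_const_mul]
    have : ∫ s, Φ s ∂P ≤ 2 * ∫ s, R s ∂P := integral_iSup_deviation_le hl hC hmeas m
    linarith
  -- Changing one point moves `Φ` by at most `b` and `R` by at most `b / 2`, hence `Φ - 2R` by at
  -- most `2b`; the variance proxy is `m b²`.
  have hsub := hasSubgaussianMGF_of_bounded_differences D (2 * b).toNNReal m
    (f := fun s => Φ s - 2 * R s)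
    (C := ((∑ _ : Fin m, |(-1 : ℝ)|) * b + m * b) + 2 * ((∑ _ : Fin m, (1 : ℝ)) * b))
    (hΦm.sub (hRm.const_mul 2))
    (fun s => (abs_sub _ _).trans (add_le_add (hΦC s) (by
      rw [abs_mul, abs_two]; linarith [hRC s])))
    (fun s i z => by
      rw [Real.coe_toNNReal _ (by positivity)]
      linarith [hΦu s i z, (abs_le.1 (hRu s i z)).1])
  have hcher := hsub.measure_ge_le hε
  have hpar : ((m * ((2 * b).toNNReal / 2) ^ 2 : NNReal) : ℝ) = m * b ^ 2 := by
    push_cast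
    rw [Real.coe_toNNReal _ (by positivity)]
    ring
  rw [hpar] at hcher
  refine (measure_mono fun S hS => ?_).trans
    ((ENNReal.le_ofReal_iff_toReal_le (measure_ne_top _ _) (Real.exp_pos _).le).2 hcher)
  simp only [Set.mem_ofPred_eq, not_forall, not_lt] at hS ⊢
  obtain ⟨h, hh⟩ := hS
  have h1 : ∑ i, (-1) * l h (S i) + m * ∫ z, l h z ∂D ≤ Φ S := le_ciSup (hΦbdd S) h
  rw [← Finset.mul_sum] at h1
  change _ ≤ Φ S - 2 * R S - _
  have h2 : rademacherSum (fun i h => l h (S i)) = R S := rfl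
  rw [h2] at hh
  linarith

end Symmetrization

/-! ### Squared losses on `[-B, B]` and the explainer loss -/

theorem sq_sub_mem_Icc {B : ℝ} (a b : LabelSpace B) :
    ((a : ℝ) - (b : ℝ)) ^ 2 ∈ Set.Icc 0 (4 * B ^ 2) := by
  obtain ⟨a, ha1, ha2⟩ := a
  obtain ⟨b, hb1, hb2⟩ := b
  refine ⟨sq_nonneg _, ?_⟩
  have : |a - b| ≤ 2 * B := abs_le.2 ⟨by linarith, by linarith⟩
  calc (a - b) ^ 2 = |a - b| ^ 2 := (sq_abs _).symm
    _ ≤ (2 * B) ^ 2 := pow_le_pow_left₀ (abs_nonneg _) this 2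
    _ = 4 * B ^ 2 := by ring

theorem abs_sq_sub_le {B : ℝ} (a b : LabelSpace B) :
    |((a : ℝ) - (b : ℝ)) ^ 2| ≤ 4 * B ^ 2 := by
  rw [abs_of_nonneg (sq_sub_mem_Icc a b).1]
  exact (sq_sub_mem_Icc a b).2

theorem abs_label_le {B : ℝ} (a : LabelSpace B) : |(a : ℝ)| ≤ B := abs_le.2 a.2

/-- On `[-B, B]` the squared loss is `4 B`-Lipschitz in the prediction. -/
theorem abs_sq_sub_sub_sq_sub_le {B : ℝ} (a b y : LabelSpace B) :
    |((a : ℝ) - y) ^ 2 - ((b : ℝ) - y) ^ 2| ≤ 4 * B * |(a : ℝ) - b| := by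
  have h1 : ((a : ℝ) - y) ^ 2 - ((b : ℝ) - y) ^ 2 = ((a : ℝ) + b - 2 * y) * (a - b) := by ring
  rw [h1, abs_mul]
  refine mul_le_mul_of_nonneg_right (abs_le.2 ⟨?_, ?_⟩) (abs_nonneg _) <;>
    linarith [a.2.1, a.2.2, b.2.1, b.2.2, y.2.1, y.2.2]

/-- The difference of the two sides is the square of `(a - b) + (c - b)`. -/
theorem sq_sub_le_two_mul_add (a b c : ℝ) : (a - c) ^ 2 ≤ 2 * (b - a) ^ 2 + 2 * (b - c) ^ 2 := by
  nlinarith [sq_nonneg ((a - b) + (c - b))]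

section Explainer

variable {X : Type*} [MeasurableSpace X] {B : ℝ} {N : Kernel X X} [IsMarkovKernel N]
  {g : X → X → LabelSpace B}

theorem integrable_sq_sub (hg : Measurable (Function.uncurry g)) (x : X) (y : LabelSpace B)
    (P : Measure X) [IsFiniteMeasure P] :
    Integrable (fun x' => ((g x' x : ℝ) - (y : ℝ)) ^ 2) P := by
  have : Measurable fun x' => g x' x := hg.comp measurable_prodMk_right
  exact integrable_of_abs_le (((measurable_subtype_coe.comp this).sub_const _).pow_const 2)
    fun x' => abs_sq_sub_le _ _

theorem explainerLoss_mem_Icc (hg : Measurable (Function.uncurry g)) (z : X × LabelSpace B) :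
    explainerLoss N g z ∈ Set.Icc 0 (4 * B ^ 2) := by
  refine ⟨integral_nonneg fun x' => sq_nonneg _, ?_⟩
  exact (integral_mono (integrable_sq_sub hg z.1 z.2 _) (integrable_const _)
    fun x' => (sq_sub_mem_Icc _ _).2).trans (by simp)

theorem measurable_explainerLoss (hg : Measurable (Function.uncurry g)) :
    Measurable (explainerLoss N g) := by
  have : StronglyMeasurable fun w : (X × LabelSpace B) × X =>
      ((g w.2 w.1.1 : ℝ) - (w.1.2 : ℝ)) ^ 2 := by
    have h1 : Measurable fun w : (X × LabelSpace B) × X => g w.2 w.1.1 :=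
      hg.comp (by fun_prop : Measurable fun w : (X × LabelSpace B) × X => (w.2, w.1.1))
    exact (((measurable_subtype_coe.comp h1).sub (by fun_prop)).pow_const 2).stronglyMeasurable
  exact (StronglyMeasurable.integral_kernel_prod_right' (κ := N.comap Prod.fst measurable_fst)
    this).measurable

theorem measurable_mnfAt {f : X → LabelSpace B} (hf : Measurable f)
    (hg : Measurable (Function.uncurry g)) : Measurable (mnfAt N f g) := by
  have : StronglyMeasurable fun w : X × X => ((f w.1 : ℝ) - (g w.2 w.1 : ℝ)) ^ 2 := by
    have h1 : Measurable fun w : X × X => g w.2 w.1 := hg.comp measurable_swap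
    exact (((measurable_subtype_coe.comp (hf.comp measurable_fst)).sub
      (measurable_subtype_coe.comp h1)).pow_const 2).stronglyMeasurable
  exact (StronglyMeasurable.integral_kernel_prod_right' (κ := N) this).measurable

theorem integrable_sq_sub' (f : X → LabelSpace B) (hg : Measurable (Function.uncurry g)) (x : X) :
    Integrable (fun x' => ((f x : ℝ) - (g x' x : ℝ)) ^ 2) (N x) := by
  simpa only [← neg_sub ((g _ x : LabelSpace B) : ℝ) (f x : ℝ), neg_sq] using
    integrable_sq_sub hg x (f x) (N x)

theorem abs_mnfAt_le (f : X → LabelSpace B) (x : X) : |mnfAt N f g x| ≤ 4 * B ^ 2 :=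
  abs_integral_le_of_abs_le fun _ => abs_sq_sub_le _ _

theorem explainerLoss_le (f : X → LabelSpace B) (hg : Measurable (Function.uncurry g))
    (z : X × LabelSpace B) :
    explainerLoss N g z ≤ 2 * mnfAt N f g z.1 + 2 * ((f z.1 : ℝ) - z.2) ^ 2 := by
  have i1 := (integrable_sq_sub' (N := N) f hg z.1).const_mul 2
  calc explainerLoss N g z
      ≤ ∫ x', (2 * ((f z.1 : ℝ) - (g x' z.1 : ℝ)) ^ 2 + 2 * ((f z.1 : ℝ) - z.2) ^ 2) ∂(N z.1) :=
        integral_mono (integrable_sq_sub hg _ _ _) (i1.add (integrable_const _))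
          fun x' => sq_sub_le_two_mul_add _ _ _
    _ = _ := by
        rw [integral_add i1 (integrable_const _), integral_const_mul]
        simp [mnfAt]

theorem sq_sub_le_mnfAt_add_explainerLoss (f : X → LabelSpace B)
    (hg : Measurable (Function.uncurry g)) (z : X × LabelSpace B) :
    ((f z.1 : ℝ) - z.2) ^ 2 ≤ 2 * mnfAt N f g z.1 + 2 * explainerLoss N g z := by
  have i1 := (integrable_sq_sub' (N := N) f hg z.1).const_mul 2
  have i2 := (integrable_sq_sub hg z.1 z.2 (N z.1)).const_mul 2
  calc ((f z.1 : ℝ) - z.2) ^ 2 = ∫ _, ((f z.1 : ℝ) - z.2) ^ 2 ∂(N z.1) := by simp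
    _ ≤ ∫ x', (2 * ((f z.1 : ℝ) - (g x' z.1 : ℝ)) ^ 2 +
          2 * ((g x' z.1 : ℝ) - (z.2 : ℝ)) ^ 2) ∂(N z.1) := by
        refine integral_mono (integrable_const _) (i1.add i2) fun x' => ?_
        have := sq_sub_le_two_mul_add (f z.1 : ℝ) (g x' z.1 : ℝ) (z.2 : ℝ)
        rwa [← neg_sub (f z.1 : ℝ) (g x' z.1 : ℝ), neg_sq] at this
    _ = _ := by
        rw [integral_add i1 i2, integral_const_mul, integral_const_mul]
        rfl

theorem testMSE_le (D : Measure (X × LabelSpace B)) [IsProbabilityMeasure D]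
    {f : X → LabelSpace B} (hf : Measurable f) (hg : Measurable (Function.uncurry g)) :
    testMSE D f ≤ 2 * mnf D N f g + 2 * ∫ z, explainerLoss N g z ∂D := by
  have i0 : Integrable (fun z : X × LabelSpace B => ((f z.1 : ℝ) - z.2) ^ 2) D := by
    refine integrable_of_abs_le ?_ fun z => abs_sq_sub_le _ _
    exact ((measurable_subtype_coe.comp (hf.comp measurable_fst)).sub (by fun_prop)).pow_const 2
  have i1 : Integrable (fun z : X × LabelSpace B => 2 * mnfAt N f g z.1) D :=
    (integrable_of_abs_le ((measurable_mnfAt hf hg).comp measurable_fst)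
      fun z => abs_mnfAt_le f z.1).const_mul 2
  have i2 : Integrable (fun z => 2 * explainerLoss N g z) D :=
    (integrable_of_abs_le (measurable_explainerLoss hg)
      fun z => abs_integral_le_of_abs_le fun _ => abs_sq_sub_le _ _).const_mul 2
  refine (integral_mono i0 (i1.add i2) fun z => sq_sub_le_mnfAt_add_explainerLoss f hg z).trans ?_
  rw [Pi.add_def, integral_add i1 i2, integral_const_mul, integral_const_mul]
  rfl

/-- With the common measure `μ`, the losses at all sample points are integrals over the same source
point `x'`, so suprema can be taken pointwise in `x'`. -/
theorem explainerLoss_eq_integral_rnDeriv {μ : Measure X} [SigmaFinite μ] (hN : ∀ x, N x ≪ μ)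
    (z : X × LabelSpace B) :
    explainerLoss N g z =
      ∫ x', ((N z.1).rnDeriv μ x').toReal * ((g x' z.1 : ℝ) - (z.2 : ℝ)) ^ 2 ∂μ :=
  (integral_rnDeriv_smul (hN z.1)).symm

end Explainer

/-! ### Complexity of the explainer class -/

/-- The support function of a bounded family is continuous in the direction. -/
theorem continuous_iSup_sum_mul {ι H : Type*} [Fintype ι] [Nonempty H] {a : ι → H → ℝ} {C : ℝ}
    (ha : ∀ i h, |a i h| ≤ C) : Continuous fun e : ι → ℝ => ⨆ h, ∑ i, e i * a i h := by
  have hlip : ∀ e e' : ι → ℝ, |(⨆ h, ∑ i, e i * a i h) - ⨆ h, ∑ i, e' i * a i h| ≤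
      (∑ i, |e i - e' i|) * C := by
    intro e e'
    refine abs_ciSup_sub_ciSup_le (bddAbove_range_sum_mul ha e) (bddAbove_range_sum_mul ha e')
      fun h => ?_
    rw [← Finset.sum_sub_distrib]
    simp_rw [← sub_mul]
    exact abs_sum_mul_le ha (fun i => e i - e' i) h
  refine continuous_iff_continuousAt.2 fun e' => ?_
  rw [ContinuousAt, tendsto_iff_dist_tendsto_zero]
  refine squeeze_zero (fun _ => dist_nonneg) (fun e => hlip e e') ?_
  have : Continuous fun e : ι → ℝ => (∑ i, |e i - e' i|) * C := by fun_prop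
  simpa using this.tendsto e'

section Complexity

variable {X : Type*} {B : ℝ}

/-- Undoing the normalizations `1 / |T|` and `√(|T| / m)` leaves the factor `√m √|T|`; this is the
subsample hypothesis of `rademacherSum_weighted_le` with `K = maxRademacher · √m`. -/
theorem rademacherSum_subsample_le {Gloc : Set (X → LabelSpace B)} {m : ℕ}
    (x : Fin m → X) (T : Finset (Fin m)) (hT : T.Nonempty) :
    rademacherSum (fun (i : ↥T) (h : Gloc) => (h.1 (x i) : ℝ)) ≤
      maxRademacher Gloc x * √(m : ℝ) * √(T.card : ℝ) := by
  have hT0 : (0 : ℝ) < T.card := by exact_mod_cast hT.card_pos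
  have hm : 0 < m := by
    obtain ⟨i, _⟩ := hT
    exact i.pos
  have hm0 : (0 : ℝ) < √(m : ℝ) := Real.sqrt_pos.2 (by exact_mod_cast hm)
  have hle : empiricalRademacher Gloc (fun i : ↥T => x i) * √((T.card : ℝ) / m) ≤
      maxRademacher Gloc x :=
    le_ciSup (f := fun T : {T : Finset (Fin m) // T.Nonempty} =>
      empiricalRademacher Gloc (fun i : ↥T.1 => x i) * √((T.1.card : ℝ) / (m : ℝ)))
      (Set.finite_range _).bddAbove ⟨T, hT⟩
  have hemp : empiricalRademacher Gloc (fun i : ↥T => x i) =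
      1 / (T.card : ℝ) * rademacherSum (fun (i : ↥T) (h : Gloc) => (h.1 (x i) : ℝ)) := by
    unfold empiricalRademacher rademacherSum
    rw [Finset.mul_expect]
    refine Finset.expect_congr rfl fun σ _ => ?_
    rw [Real.mul_iSup_of_nonneg (by positivity), Fintype.card_coe]
  rw [hemp, Real.sqrt_div hT0.le] at hle
  have hs : √(T.card : ℝ) * √(T.card : ℝ) = T.card := Real.mul_self_sqrt hT0.le
  have hs0 : 0 < √(T.card : ℝ) := Real.sqrt_pos.2 hT0
  calc _ = 1 / (T.card : ℝ) * rademacherSum (fun (i : ↥T) (h : Gloc) => (h.1 (x i) : ℝ)) *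
        (√(T.card : ℝ) / √(m : ℝ)) * √(m : ℝ) * √(T.card : ℝ) := by
        field_simp
        rw [sq, hs]
    _ ≤ _ := by gcongr

theorem maxRademacher_nonneg {Gloc : Set (X → LabelSpace B)} [Nonempty Gloc] {m : ℕ}
    (x : Fin m → X) : 0 ≤ maxRademacher Gloc x := by
  refine Real.iSup_nonneg fun T => mul_nonneg ?_ (Real.sqrt_nonneg _)
  have h := rademacherSum_nonneg (a := fun (i : ↥T.1) (h : Gloc) => (h.1 (x i) : ℝ)) (C := B)
    fun i h => abs_label_le _
  unfold empiricalRademacher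
  simp_rw [← Real.mul_iSup_of_nonneg (show (0 : ℝ) ≤ 1 / (Fintype.card ↥T.1 : ℝ) by positivity)]
  rw [← Finset.mul_expect]
  exact mul_nonneg (by positivity) h

/-- Rademacher averages of weighted squared losses over the local class. -/
theorem rademacherSum_weighted_sq_sub_le (hB : 0 < B) {Gloc : Set (X → LabelSpace B)}
    [Nonempty Gloc] {m : ℕ} (hm : 0 < m) (S : Fin m → X × LabelSpace B) {p : Fin m → ℝ}
    (hp : ∀ i, 0 ≤ p i) :
    rademacherSum (fun i (h : Gloc) => p i * ((h.1 (S i).1 : ℝ) - ((S i).2 : ℝ)) ^ 2) ≤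
      m * (4 * B * maxRademacher Gloc (fun i => (S i).1) * (Real.log m + 1)) *
        √((1 / (m : ℝ)) * ∑ i, p i ^ 2) := by
  obtain ⟨K, hK⟩ : ∃ K, ∀ i, p i ≤ K := by
    obtain ⟨K, hK⟩ := (Set.finite_range p).bddAbove
    exact ⟨K, fun i => hK ⟨i, rfl⟩⟩
  have hm0 : (0 : ℝ) < m := by exact_mod_cast hm
  have h1 : rademacherSum (fun i (h : Gloc) => p i * ((h.1 (S i).1 : ℝ) - ((S i).2 : ℝ)) ^ 2) ≤
      rademacherSum (fun i (h : Gloc) => 4 * B * (p i * (h.1 (S i).1 : ℝ))) := by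
    refine rademacherSum_le_of_abs_sub_le (C := K * (4 * B ^ 2)) (fun i h => ?_) (fun i h => ?_)
      fun i h h' => ?_
    · rw [abs_mul, abs_of_nonneg (hp i)]
      exact mul_le_mul (hK i) (abs_sq_sub_le _ _) (abs_nonneg _) ((hp i).trans (hK i))
    · rw [abs_mul, abs_mul (p i), abs_of_nonneg (hp i), abs_of_nonneg (by positivity : 0 ≤ 4 * B)]
      calc 4 * B * (p i * |(h.1 (S i).1 : ℝ)|) ≤ 4 * B * (K * B) :=
            mul_le_mul_of_nonneg_left (mul_le_mul (hK i) (abs_label_le _) (abs_nonneg _)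
              ((hp i).trans (hK i))) (by positivity)
        _ = _ := by ring
    · rw [← mul_sub, ← mul_sub, ← mul_sub, abs_mul, abs_mul (4 * B), abs_mul (p i),
        abs_of_nonneg (by positivity : 0 ≤ 4 * B), mul_left_comm, abs_of_nonneg (hp i)]
      exact mul_le_mul_of_nonneg_left (abs_sq_sub_sub_sq_sub_le _ _ _) (hp i)
  rw [rademacherSum_const_mul _ (by positivity)] at h1
  have h2 := rademacherSum_weighted_le (C := B)
    (a := fun i (h : Gloc) => (h.1 (S i).1 : ℝ))
    (fun i h => abs_label_le _)
    (mul_nonneg (maxRademacher_nonneg (Gloc := Gloc) fun i => (S i).1) (Real.sqrt_nonneg (m : ℝ)))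
    (rademacherSum_subsample_le fun i => (S i).1) hp
  have h3 : √(m : ℝ) * √(∑ i, p i ^ 2) = m * √((1 / (m : ℝ)) * ∑ i, p i ^ 2) := by
    rw [Real.sqrt_mul (by positivity), Real.sqrt_div zero_le_one, Real.sqrt_one]
    have : √(m : ℝ) * √(m : ℝ) = m := Real.mul_self_sqrt hm0.le
    have h0 : 0 < √(m : ℝ) := Real.sqrt_pos.2 hm0
    field_simp
    rw [sq, this, mul_comm]
  calc _ ≤ 4 * B * _ := h1
    _ ≤ 4 * B * _ := mul_le_mul_of_nonneg_left h2 (by positivity)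
    _ = 4 * B * maxRademacher Gloc (fun i => (S i).1) * (Real.log m + 1) *
          (√(m : ℝ) * √(∑ i, p i ^ 2)) := by ring
    _ = _ := by rw [h3]; ring

/-- The Rademacher average of the explainer losses is controlled by the disjointedness factor and
the complexity of the local class. -/
theorem rademacherSum_explainerLoss_le [MeasurableSpace X] (hB : 0 < B) {μ : Measure X}
    [SigmaFinite μ] {N : Kernel X X} [IsMarkovKernel N] (hN : ∀ x, N x ≪ μ)
    {Gloc : Set (X → LabelSpace B)} {G : Set (X → X → LabelSpace B)} [Nonempty G]
    (hG : ∀ g ∈ G, Measurable (Function.uncurry g)) (hGloc : ∀ g ∈ G, ∀ x', g x' ∈ Gloc)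
    [Nonempty Gloc] {m : ℕ} (hm : 0 < m) (S : Fin m → X × LabelSpace B) :
    rademacherSum (fun i (g : G) => explainerLoss N g.1 (S i)) ≤
      m * (4 * B * maxRademacher Gloc (fun i => (S i).1) * (Real.log m + 1)) *
        disjointednessFactor μ N (fun i => (S i).1) := by
  let p : Fin m → X → ℝ := fun i x' => ((N (S i).1).rnDeriv μ x').toReal
  have hp0 : ∀ i x', 0 ≤ p i x' := fun i x' => ENNReal.toReal_nonneg
  have hpm : ∀ i, Measurable (p i) := fun i => (Measure.measurable_rnDeriv _ _).ennreal_toReal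
  have hpi : ∀ i, Integrable (p i) μ := fun i => Measure.integrable_toReal_rnDeriv
  let a : Fin m → Gloc → ℝ := fun i h => ((h.1 (S i).1 : ℝ) - ((S i).2 : ℝ)) ^ 2
  have ha : ∀ i h, |a i h| ≤ 4 * B ^ 2 := fun i h => abs_sq_sub_le _ _
  let W : (Fin m → ℤˣ) → X → ℝ := fun σ x' => ⨆ h, ∑ i, (((σ i : ℤ) : ℝ) * p i x') * a i h
  -- `Gloc` may be uncountable; measurability comes from continuity of the support function in the
  -- weights.
  have hWm : ∀ σ, Measurable (W σ) := fun σ =>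
    (continuous_iSup_sum_mul ha).measurable.comp
      (measurable_pi_iff.2 fun i => (hpm i).const_mul _)
  have hWi : ∀ σ, Integrable (W σ) μ := by
    intro σ
    refine Integrable.mono' ((integrable_finsetSum Finset.univ fun i _ => hpi i).mul_const
      (4 * B ^ 2)) (hWm σ).aestronglyMeasurable (ae_of_all _ fun x' => ?_)
    rw [Real.norm_eq_abs]
    refine abs_iSup_le_of_forall fun h => (abs_sum_mul_le ha _ h).trans (le_of_eq ?_)
    congr 1
    refine Finset.sum_congr rfl fun i _ => ?_
    rw [abs_mul, abs_of_nonneg (hp0 i x')]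
    rcases Int.units_eq_one_or (σ i) with h | h <;> simp [h]
  have hWrad : ∀ x', 𝔼 σ, W σ x' = rademacherSum (fun i h => p i x' * a i h) := by
    intro x'
    simp only [W, rademacherSum, mul_assoc]
  have hρi : Integrable (fun x' => √((1 / (m : ℝ)) * ∑ i, p i x' ^ 2)) μ := by
    refine Integrable.mono' (integrable_finsetSum Finset.univ fun i _ => hpi i)
      (by fun_prop) (ae_of_all _ fun x' => ?_)
    rw [Real.norm_eq_abs, abs_of_nonneg (Real.sqrt_nonneg _)]
    refine Real.sqrt_le_iff.2 ⟨Finset.sum_nonneg fun i _ => hp0 i x', ?_⟩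
    have h1 : 1 / (m : ℝ) ≤ 1 := by
      rw [div_le_one (by exact_mod_cast hm)]; exact_mod_cast hm
    exact (mul_le_of_le_one_left (Finset.sum_nonneg fun i _ => sq_nonneg _) h1).trans
      (Finset.sum_sq_le_sq_sum_of_nonneg fun i _ => hp0 i x')
  calc rademacherSum (fun i (g : G) => explainerLoss N g.1 (S i))
      ≤ 𝔼 σ, ∫ x', W σ x' ∂μ := by
        refine Finset.expect_le_expect fun σ _ => ciSup_le fun g => ?_
        have hint : ∀ i, Integrable (fun x' => ((σ i : ℤ) : ℝ) *
            (p i x' * ((g.1 x' (S i).1 : ℝ) - ((S i).2 : ℝ)) ^ 2)) μ := fun i =>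
          ((integrable_rnDeriv_smul_iff (hN _)).2
            (integrable_sq_sub (hG g.1 g.2) (S i).1 (S i).2 _)).const_mul _
        simp_rw [explainerLoss_eq_integral_rnDeriv hN, ← integral_const_mul]
        rw [← integral_finsetSum _ fun i _ => hint i]
        refine integral_mono (integrable_finsetSum _ fun i _ => hint i) (hWi σ) fun x' => ?_
        -- At each `x'` the local explanation `g x'` competes in the supremum over `Gloc`.
        refine le_trans (le_of_eq ?_) (le_ciSup (bddAbove_range_sum_mul ha
          (fun i => ((σ i : ℤ) : ℝ) * p i x')) ⟨g.1 x', hGloc g.1 g.2 x'⟩)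
        simp only [a, p, mul_assoc]
    _ = ∫ x', 𝔼 σ, W σ x' ∂μ := (integral_expect hWi).symm
    _ ≤ ∫ x', m * (4 * B * maxRademacher Gloc (fun i => (S i).1) * (Real.log m + 1)) *
          √((1 / (m : ℝ)) * ∑ i, p i x' ^ 2) ∂μ := by
        refine integral_mono ?_ (hρi.const_mul _) fun x' => ?_
        · simp_rw [Fintype.expect_eq_sum_div_card]
          exact (integrable_finsetSum _ fun σ _ => hWi σ).div_const _
        · simp only
          rw [hWrad]
          exact rademacherSum_weighted_sq_sub_le hB hm S fun i => hp0 i x'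
    _ = _ := by rw [integral_const_mul]; rfl

end Complexity

/-! ### The generalization bound -/

theorem theorem1 {X : Type*} [MeasurableSpace X] {B : ℝ} (hB : 0 < B)
    -- the data distribution on `X × [-B, B]`
    (D : Measure (X × LabelSpace B)) [IsProbabilityMeasure D]
    -- the reference measure and the mirrored neighborhood distributions, which have densities
    (μ : Measure X) [SigmaFinite μ]
    (N : Kernel X X) [IsMarkovKernel N] (hN : ∀ x, N x ≪ μ)
    -- the model class, the local explanation class and the class of explainers
    (F : Set (X → LabelSpace B)) (hF : ∀ f ∈ F, Measurable f)
    (Gloc : Set (X → LabelSpace B))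
    (G : Set (X → X → LabelSpace B))
    (hG : ∀ g ∈ G, Measurable (Function.uncurry g))
    (hGloc : ∀ g ∈ G, ∀ x', g x' ∈ Gloc)
    (hGmeas : IsMeasurableClass D N G)
    {m : ℕ} (hm : 0 < m) {δ : ℝ} (hδ : 0 < δ) (hδ1 : δ < 1) :
    -- the (outer) probability that the bound fails for some `f` and `g` is at most `δ`
    Measure.pi (fun _ : Fin m => D)
      {S | ¬ ∀ f ∈ F, ∀ g ∈ G,
        testMSE D f ≤ 4 * trainMSE S f + 2 * mnf D N f g + 4 * empiricalMNF N S f g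
          + 16 * B * disjointednessFactor μ N (fun i => (S i).1)
              * maxRademacher Gloc (fun i => (S i).1) * (Real.log m + 1)
          + 8 * B ^ 2 * √(2 * Real.log (1 / δ) / m)} ≤ ENNReal.ofReal δ := by
  rcases isEmpty_or_nonempty G with hGe | hGne
  · have : {S : Fin m → X × LabelSpace B | ¬ ∀ f ∈ F, ∀ g ∈ G,
        testMSE D f ≤ 4 * trainMSE S f + 2 * mnf D N f g + 4 * empiricalMNF N S f g
          + 16 * B * disjointednessFactor μ N (fun i => (S i).1)
              * maxRademacher Gloc (fun i => (S i).1) * (Real.log m + 1)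
          + 8 * B ^ 2 * √(2 * Real.log (1 / δ) / m)} = ∅ :=
      Set.eq_empty_of_forall_notMem fun S hS => hS fun f _ g hg => (hGe.false ⟨g, hg⟩).elim
    rw [this]
    simp
  have hGlocne : Nonempty Gloc := by
    obtain ⟨z⟩ := nonempty_of_isProbabilityMeasure D
    obtain ⟨g, hg⟩ := hGne
    exact ⟨⟨g z.1, hGloc g hg z.1⟩⟩
  have hm0 : (0 : ℝ) < m := by exact_mod_cast hm
  have hL : 0 < Real.log (1 / δ) := Real.log_pos (by rw [lt_div_iff₀ hδ]; linarith)
  set r := √(2 * Real.log (1 / δ) / m) with hr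
  have hr2 : r ^ 2 = 2 * Real.log (1 / δ) / m := Real.sq_sqrt (by positivity)
  have hdev := measure_uniform_deviation_le (D := D) (b := 4 * B ^ 2)
    (l := fun g : G => explainerLoss N g.1)
    (fun g => measurable_explainerLoss (hG g.1 g.2))
    (fun g z => explainerLoss_mem_Icc (hG g.1 g.2) z) hGmeas m
    (ε := m * (4 * B ^ 2 * r)) (by positivity)
  -- With `b = 4B²` the exponent is `-m r² / 2 = log δ`, which dictates the choice of `ε`.
  have hexp : Real.exp (-(m * (4 * B ^ 2 * r)) ^ 2 / (2 * (m * (4 * B ^ 2) ^ 2))) = δ := by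
    have : -(m * (4 * B ^ 2 * r)) ^ 2 / (2 * (m * (4 * B ^ 2) ^ 2)) = Real.log δ := by
      rw [mul_pow, mul_pow _ r, hr2, one_div, Real.log_inv]
      field_simp
    rw [this, Real.exp_log hδ]
  rw [hexp] at hdev
  refine (measure_mono fun S hS => ?_).trans hdev
  intro hgood
  refine hS fun f hf g hg => ?_
  have h1 := hgood ⟨g, hg⟩
  have h2 := rademacherSum_explainerLoss_le hB hN hG hGloc hm S
  have h3 := testMSE_le (N := N) D (hF f hf) (hG g hg)
  have h4 : ∑ i, explainerLoss N g (S i) ≤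
      m * (2 * empiricalMNF N S f g + 2 * trainMSE S f) := by
    have : m * (2 * empiricalMNF N S f g + 2 * trainMSE S f) =
        ∑ i, (2 * mnfAt N f g (S i).1 + 2 * ((f (S i).1 : ℝ) - (S i).2) ^ 2) := by
      rw [Finset.sum_add_distrib, ← Finset.mul_sum, ← Finset.mul_sum, empiricalMNF, trainMSE]
      field_simp
    rw [this]
    exact Finset.sum_le_sum fun i _ => explainerLoss_le f (hG g hg) (S i)
  -- Multiplying `h1` out by `1 / m` gives these constants; the factor `2` in `h3` doubles them to
  -- `4`, `4`, `16B` and `8B²`.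
  have h5 : ∫ z, explainerLoss N g z ∂D ≤ 2 * empiricalMNF N S f g + 2 * trainMSE S f +
      2 * (4 * B * maxRademacher Gloc (fun i => (S i).1) * (Real.log m + 1) *
        disjointednessFactor μ N (fun i => (S i).1)) + 4 * B ^ 2 * r := by
    refine le_of_mul_le_mul_left ?_ hm0
    simp only at h1
    linarith
  linarith
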